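/- **Setting.** Let $\mathcal S\subset\mathbb R^{d_S}$ ($d_S\ge 1$) be a convex state space, $\mathcal A\subset\mathbb R^{d_A}$ an action space, $\mathcal Z=\mathcal S\times\mathcal A$, $d=d_S+1$, and let $H$ be the episode length, $K$ the number of episodes, $T=KH$. The unknown reward and (deterministic) transition functions $f=[f_R,f_S]:\mathcal Z\to\mathbb R\times\mathcal S$ are drawn from a centred multi-output Gaussian process with known matrix-valued kernel $\kappa:\mathcal Z\times\mathcal Z\to\mathbb R^{d\times d}$. For a policy $\pi=(\pi_h)_h$, $\pi_h:\mathcal S\to\mathcal A$, let $V^\pi_h(s)$ be the total reward collected in steps $h,\dots,H$ from $s_h=s$ under $\pi$, and $Q^\pi_h(s,a)$ the same when the action at step $h$ is $a$; put $V^\star_h=\max_\pi V^\pi_h$, $Q^\star_h=\max_\pi Q^\pi_h$. It is assumed that an optimal policy exists, that all maxima over actions below are attained, and that the posterior mean transition takes values in $\mathcal S$. At the start of episode $k$ the buffer contains the inputs $z_{h,j}=(s_{h,j},a_{h,j})$ and outputs $y_{h,j}=f(z_{h,j})$ for $j<k$, $1\le h\le H$. With $\lambda>0$, $\mathbf K$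 the block kernel matrix of these inputs, $\mathbf k(z)$ the cross-covariance with a point $z$, and $\mathbf y$ the stacked outputs, let $$\mu_k(z)=\mathbf k(z)^\top(\mathbf K+\lambda^2\mathbf I)^{-1}\mathbf y,\qquad \Sigma_k(z,z')=\kappa(z,z')-\mathbf k(z)^\top(\mathbf K+\lambda^2\mathbf I)^{-1}\mathbf k(z'),\qquad \sigma_{k,i}(z)=\Sigma_k(z,z)_{ii}^{1/2},$$ with reward and state parts $\mu_{R,k},\sigma_{R,k}$ and $\mu_{S,k},\sigma_{S,k}$. Given the past, the algorithm samples $\hat f_k=[\hat f_{R,k},\hat f_{S,k}]:\mathcal Z\to\mathbb R\times\mathcal S$ from $\mathrm{GP}(\mu_k,\Sigma_k)$, computes the proxies $$Q_{h,k}(s,a)=\hat f_{R,k}(s,a)+V_{h+1,k}(\hat f_{S,k}(s,a)),\quad V_{h,k}(s)=\max_{a\in\mathcal A}Q_{h,k}(s,a),\quad V_{H+1,k}=0,$$ and in episode $k$, from an initial state $s_{1,k}$ chosen by the environment, plays $a_{h,k}\in\arg\max_a Q_{h,k}(s_{h,k},a)$ and moves to $s_{h+1,k}=f_S(s_{h,k},a_{h,k})$.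 **Widths.** Let $\delta\in(0,1)$ and $\delta'=\delta/(Td)$. Let $\beta_k(\delta')\in[0,\infty)$ be a confidence multiplier for episode $k$, that is, at least the smallest $b$ such that for each output $i$, and both for $g=f_i$ and for $g=\hat f_{k,i}$, with probability at least $1-\delta'$ one has $|g(z)-\mu_{k,i}(z)|\le b\,\sigma_{k,i}(z)$ simultaneously for all $z\in\mathcal Z$ (this smallest $b$ is assumed finite). For constants $u_G,u_H$ put $$\xi_k(s,a)=\beta_k(\delta')\sigma_{R,k}(s,a)+u_G\,\beta_k(\delta')\|\sigma_{S,k}(s,a)\|+\tfrac12u_H\,\beta_k(\delta')^2\|\sigma_{S,k}(s,a)\|^2 ,$$ and define, with $V^u_{H+1,k}=V^l_{H+1,k}=0$, $$Q^u_{h,k}(s,a)=\mu_{R,k}(s,a)+V^u_{h+1,k}(\mu_{S,k}(s,a))+\xi_k(s,a),\quad V^u_{h,k}(s)=\max_{a\in\mathcal A}Q^u_{h,k}(s,a),$$ $$Q^l_{h,k}(s,a)=\mu_{R,k}(s,a)+V^l_{h+1,k}(\mu_{S,k}(s,a))-\xi_k(s,a),\quad V^l_{h,k}(s)=\max_{a\in\mathcal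 A}Q^l_{h,k}(s,a).$$ **Claim.** There is an event of probability at least $1-\delta$ on which the following holds: if the value functions $V^\star_h$ and $V_{h,k}$ ($1\le h\le H$, $1\le k\le K$) are twice differentiable on $\mathcal S$ with gradients bounded by $u_G$ in norm and Hessians bounded by $u_H$ in operator norm, then for all $h\in\{1,\dots,H\}$, $k\in\{1,\dots,K\}$, $s\in\mathcal S$, $a\in\mathcal A$, $$Q^l_{h,k}(s,a)\le Q_{h,k}(s,a)\le Q^u_{h,k}(s,a)\qquad\text{and}\qquad Q^l_{h,k}(s,a)\le Q^\star_h(s,a)\le Q^u_{h,k}(s,a).$$ In particular, if this smoothness holds almost surely, these bounds hold with probability at least $1-\delta$. -/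

import Mathlib

open MeasureTheory ProbabilityTheory
open scoped ENNReal NNReal Matrix

noncomputable section

/-- States are vectors in `ℝ^dS` with the Euclidean norm. -/
abbrev RLState (dS : ℕ) := EuclideanSpace ℝ (Fin dS)

/-- Actions are vectors in `ℝ^dA`. -/
abbrev RLAction (dA : ℕ) := EuclideanSpace ℝ (Fin dA)

/-- A state-action pair `z = (s, a)`. -/
abbrev RLPair (dS dA : ℕ) := RLState dS × RLAction dA

/-- The `d = dS + 1` outputs of a joint reward-transition function: index `0` is the reward, the
indices `i.succ` are the coordinates of the next state. -/
abbrev RLOut (dS : ℕ) := Fin (dS + 1) → ℝ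

/-- The reward component of a joint reward-transition function. -/
def rewardPart {dS dA : ℕ} (f : RLPair dS dA → RLOut dS) (z : RLPair dS dA) : ℝ := f z 0

/-- The next-state component of a joint reward-transition function. -/
def statePart {dS dA : ℕ} (f : RLPair dS dA → RLOut dS) (z : RLPair dS dA) : RLState dS :=
  WithLp.toLp 2 (fun i => f z i.succ)

/-! ### Multi-output Gaussian process regression -/

section Posterior

variable {Z ι : Type*} [Fintype ι] [DecidableEq ι] {d : ℕ}

/-- The block kernel matrix `K` of the inputs `z`. -/
def gramMatrix (κ : Z → Z → Matrix (Fin d) (Fin d) ℝ) (z : ι → Z) :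
    Matrix (ι × Fin d) (ι × Fin d) ℝ :=
  Matrix.of fun p q => κ (z p.1) (z q.1) p.2 q.2

/-- The cross-covariance matrix between the inputs `z` and a test point `x`. -/
def crossMatrix (κ : Z → Z → Matrix (Fin d) (Fin d) ℝ) (z : ι → Z) (x : Z) :
    Matrix (ι × Fin d) (Fin d) ℝ :=
  Matrix.of fun p r => κ (z p.1) x p.2 r

/-- The posterior mean `k(x)ᵀ (K + λ² I)⁻¹ y`. -/
def posteriorMean (κ : Z → Z → Matrix (Fin d) (Fin d) ℝ) (lam : ℝ) (z : ι → Z)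
    (y : ι → Fin d → ℝ) (x : Z) : Fin d → ℝ :=
  (crossMatrix κ z x)ᵀ *ᵥ
    ((gramMatrix κ z + lam ^ 2 • (1 : Matrix (ι × Fin d) (ι × Fin d) ℝ))⁻¹ *ᵥ
      fun p => y p.1 p.2)

/-- The posterior covariance `k(x, x') - k(x)ᵀ (K + λ² I)⁻¹ k(x')`. -/
def posteriorCov (κ : Z → Z → Matrix (Fin d) (Fin d) ℝ) (lam : ℝ) (z : ι → Z) (x x' : Z) :
    Matrix (Fin d) (Fin d) ℝ :=
  κ x x' - (crossMatrix κ z x)ᵀ *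
    (gramMatrix κ z + lam ^ 2 • (1 : Matrix (ι × Fin d) (ι × Fin d) ℝ))⁻¹ * crossMatrix κ z x'

end Posterior

/-! ### Value functions of a deterministic finite-horizon decision process -/

section Values

variable {dS dA : ℕ}

/-- A policy chooses, at each step, an admissible action in every state of `S`. -/
def IsPolicy (S : Set (RLState dS)) (A : Set (RLAction dA)) (π : ℕ → RLState dS → RLAction dA) :
    Prop :=
  ∀ h, ∀ x ∈ S, π h x ∈ A

/-- The state reached from `x` (occupied at step `h`) after `n` further steps under `π`. -/
def policyState (g : RLPair dS dA → RLOut dS) (π : ℕ → RLState dS → RLAction dA) (h : ℕ)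
    (x : RLState dS) : ℕ → RLState dS
  | 0 => x
  | n + 1 => statePart g (policyState g π h x n, π (h + n) (policyState g π h x n))

/-- `V^π_h(x)`: total reward from step `h` to step `H`, starting in `x` and following `π`. -/
def policyV (H : ℕ) (g : RLPair dS dA → RLOut dS) (π : ℕ → RLState dS → RLAction dA) (h : ℕ)
    (x : RLState dS) : ℝ :=
  ∑ n ∈ Finset.range (H + 1 - h),
    rewardPart g (policyState g π h x n, π (h + n) (policyState g π h x n))

/-- `Q^π_h(x, a)`: play `a` in `x` at step `h`, follow `π` afterwards. -/
def policyQ (H : ℕ) (g : RLPair dS dA → RLOut dS) (π : ℕ → RLState dS → RLAction dA) (h : ℕ)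
    (x : RLState dS) (a : RLAction dA) : ℝ :=
  rewardPart g (x, a) + policyV H g π (h + 1) (statePart g (x, a))

/-- `V*_h(x) = max_π V^π_h(x)`. -/
def optV (S : Set (RLState dS)) (A : Set (RLAction dA)) (H : ℕ) (g : RLPair dS dA → RLOut dS)
    (h : ℕ) (x : RLState dS) : ℝ :=
  ⨆ π : {π : ℕ → RLState dS → RLAction dA // IsPolicy S A π}, policyV H g π h x

/-- `Q*_h(x, a) = max_π Q^π_h(x, a)`. -/
def optQ (S : Set (RLState dS)) (A : Set (RLAction dA)) (H : ℕ) (g : RLPair dS dA → RLOut dS)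
    (h : ℕ) (x : RLState dS) (a : RLAction dA) : ℝ :=
  ⨆ π : {π : ℕ → RLState dS → RLAction dA // IsPolicy S A π}, policyQ H g π h x a

/-- An optimal policy exists: one that is best from every state and every step. -/
def HasOptimalPolicy (S : Set (RLState dS)) (A : Set (RLAction dA)) (H : ℕ)
    (g : RLPair dS dA → RLOut dS) : Prop :=
  ∃ π, IsPolicy S A π ∧ ∀ h ∈ Finset.Icc 1 H, ∀ x ∈ S, ∀ π', IsPolicy S A π' →
    policyV H g π' h x ≤ policyV H g π h x

/-- Backward recursion with `n` steps to go, for a one-step reward `r` and a transition map `p`: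
`W_0 = 0`, `W_{n+1}(x) = max_{a ∈ A} (r(x, a) + W_n(p(x, a)))`. -/
def backupValue (A : Set (RLAction dA)) (r : RLPair dS dA → ℝ) (p : RLPair dS dA → RLState dS) :
    ℕ → RLState dS → ℝ
  | 0, _ => 0
  | n + 1, x => sSup ((fun a => r (x, a) + backupValue A r p n (p (x, a))) '' A)

/-- `V_h` of the backward recursion, so that `V_{H+1} = 0` and
`V_h(x) = max_{a ∈ A} Q_h(x, a)` for `h ≤ H`. -/
def backupV (A : Set (RLAction dA)) (H : ℕ) (r : RLPair dS dA → ℝ)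
    (p : RLPair dS dA → RLState dS) (h : ℕ) (x : RLState dS) : ℝ :=
  backupValue A r p (H + 1 - h) x

/-- `Q_h(x, a) = r(x, a) + V_{h+1}(p(x, a))`. -/
def backupQ (A : Set (RLAction dA)) (H : ℕ) (r : RLPair dS dA → ℝ)
    (p : RLPair dS dA → RLState dS) (h : ℕ) (x : RLState dS) (a : RLAction dA) : ℝ :=
  r (x, a) + backupV A H r p (h + 1) (p (x, a))

/-- The recursion in terms of `h`: `V_h(x) = sup_{a ∈ A} Q_h(x, a)` for `h ≤ H`. -/
theorem backupV_eq_sSup (A : Set (RLAction dA)) (H : ℕ) (r : RLPair dS dA → ℝ)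
    (p : RLPair dS dA → RLState dS) (h : ℕ) (hh : h ≤ H) (x : RLState dS) :
    backupV A H r p h x = sSup (backupQ A H r p h x '' A) := by
  have e : H + 1 - h = (H + 1 - (h + 1)) + 1 := by omega
  unfold backupV
  rw [e]
  rfl

/-- All maxima over actions in the backward recursion are attained. -/
def MaximaExist (S : Set (RLState dS)) (A : Set (RLAction dA)) (H : ℕ) (r : RLPair dS dA → ℝ)
    (p : RLPair dS dA → RLState dS) : Prop :=
  ∀ h ∈ Finset.Icc 1 H, ∀ x ∈ S, ∃ a ∈ A, IsMaxOn (backupQ A H r p h x) A a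

/-- `v` is twice differentiable on `S` with gradient bounded by `uG` and Hessian bounded by `uH`
in operator norm. For open `S` the derivatives within `S` are the usual ones. -/
def SmoothValue (S : Set (RLState dS)) (v : RLState dS → ℝ) (uG uH : ℝ) : Prop :=
  ∃ (v' : RLState dS → RLState dS →L[ℝ] ℝ) (v'' : RLState dS → RLState dS →L[ℝ] RLState dS →L[ℝ] ℝ),
    ∀ x ∈ S, HasFDerivWithinAt v (v' x) S x ∧ HasFDerivWithinAt v' (v'' x) S x ∧
      ‖v' x‖ ≤ uG ∧ ‖v'' x‖ ≤ uH

end Values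

/-- The smallest `b ∈ [0, ∞]` such that, with probability at least `1 - δ`, the bound
`|g(z) - m(z)| ≤ b σ(z)` holds simultaneously for all `z ∈ D`. -/
def sharpMultiplier {Ω Z : Type*} [MeasurableSpace Ω] (P : Measure Ω) (D : Set Z)
    (g m σ : Ω → Z → ℝ) (δ : ℝ) : ℝ≥0∞ :=
  ⨅ (b : ℝ≥0) (_ : P {ω | ∃ z ∈ D, (b : ℝ) * σ ω z < |g ω z - m ω z|} ≤ ENNReal.ofReal δ),
    (b : ℝ≥0∞)

/-! ### The learning problem and the algorithm -/

/-- The known data: state and action space, matrix-valued kernel, noise parameter, number of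
steps per episode, number of episodes. -/
structure RLModel (dS dA : ℕ) where
  S : Set (RLState dS)
  A : Set (RLAction dA)
  kernel : RLPair dS dA → RLPair dS dA → Matrix (Fin (dS + 1)) (Fin (dS + 1)) ℝ
  lam : ℝ
  H : ℕ
  K : ℕ

/-- The random objects: the unknown function `f = [f_R, f_S]`, the functions `fhat k` sampled in
episode `k`, and the states `s h k` and actions `a h k` at step `h` of episode `k`
(steps and episodes are numbered from `1`). Their joint law is described by `IsRLGPS` below. -/
structure RLRun (dS dA : ℕ) (Ω : Type*) where
  f : Ω → RLPair dS dA → RLOut dS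
  fhat : ℕ → Ω → RLPair dS dA → RLOut dS
  s : ℕ → ℕ → Ω → RLState dS
  a : ℕ → ℕ → Ω → RLAction dA

namespace RLModel

variable {dS dA : ℕ} {Ω : Type*} (M : RLModel dS dA) (R : RLRun dS dA Ω)

/-- The domain `S × A` of the joint reward-transition function. -/
def Dom : Set (RLPair dS dA) := M.S ×ˢ M.A

/-- The observations available when episode `k` starts: the pairs `(j, h)`, where `j < k` is an
earlier episode and `h` is one of its steps. -/
abbrev DataIdx (k : ℕ) := ↥(Finset.Ico 1 k ×ˢ Finset.Icc 1 M.H)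

/-- The inputs in the buffer at the start of episode `k`. -/
def dataIn (k : ℕ) (ω : Ω) (t : M.DataIdx k) : RLPair dS dA :=
  (R.s t.1.2 t.1.1 ω, R.a t.1.2 t.1.1 ω)

/-- The outputs (reward and next state) in the buffer at the start of episode `k`. -/
def dataOut (k : ℕ) (ω : Ω) (t : M.DataIdx k) : RLOut dS := R.f ω (M.dataIn R k ω t)

/-- Posterior mean in episode `k`. -/
def postMean (k : ℕ) (ω : Ω) : RLPair dS dA → RLOut dS :=
  posteriorMean M.kernel M.lam (M.dataIn R k ω) (M.dataOut R k ω)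

/-- Posterior covariance in episode `k`. -/
def postCov (k : ℕ) (ω : Ω) :
    RLPair dS dA → RLPair dS dA → Matrix (Fin (dS + 1)) (Fin (dS + 1)) ℝ :=
  posteriorCov M.kernel M.lam (M.dataIn R k ω)

/-- Marginal posterior standard deviations in episode `k`. -/
def postSd (k : ℕ) (ω : Ω) (z : RLPair dS dA) : RLOut dS :=
  fun i => √(M.postCov R k ω z z i i)

/-- The proxy `Q_{h,k}`. -/
def proxyQ (h k : ℕ) (ω : Ω) : RLState dS → RLAction dA → ℝ :=
  backupQ M.A M.H (rewardPart (R.fhat k ω)) (statePart (R.fhat k ω)) h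

/-- The proxy `V_{h,k}`. -/
def proxyV (h k : ℕ) (ω : Ω) : RLState dS → ℝ :=
  backupV M.A M.H (rewardPart (R.fhat k ω)) (statePart (R.fhat k ω)) h

/-- Everything that has happened before episode `k`, together with the unknown function. -/
@[reducible] def history (k : ℕ) : MeasurableSpace Ω :=
  (⨆ (z ∈ M.Dom) (i : Fin (dS + 1)),
      MeasurableSpace.comap (fun ω => R.f ω z i) inferInstance) ⊔
  (⨆ (j ∈ Finset.Ico 1 k) (z ∈ M.Dom) (i : Fin (dS + 1)),
      MeasurableSpace.comap (fun ω => R.fhat j ω z i) inferInstance) ⊔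
  (⨆ (j ∈ Finset.Ico 1 k) (h ∈ Finset.Icc 1 M.H),
      MeasurableSpace.comap (R.s h j) inferInstance ⊔
        MeasurableSpace.comap (R.a h j) inferInstance)

/-- `R` is a run of reinforcement learning with GP sampling in an environment drawn from the
multi-output prior `GP(0, kernel)`. -/
structure IsRLGPS [MeasurableSpace Ω] (P : Measure Ω) : Prop where
  /-- The prior: jointly Gaussian, centred, with covariance `kernel`. -/
  measurable_f : ∀ z ∈ M.Dom, ∀ i, Measurable fun ω => R.f ω z i
  prior_gaussian : IsGaussianProcess
    (fun (p : ↥M.Dom × Fin (dS + 1)) (ω : Ω) => R.f ω p.1 p.2) P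
  prior_mean : ∀ z ∈ M.Dom, ∀ i, ∫ ω, R.f ω z i ∂P = 0
  prior_cov : ∀ z ∈ M.Dom, ∀ z' ∈ M.Dom, ∀ i j,
    covariance (fun ω => R.f ω z i) (fun ω => R.f ω z' j) P = M.kernel z z' i j
  /-- The transition function maps `S × A` to `S`. -/
  f_mem : ∀ᵐ ω ∂P, ∀ z ∈ M.Dom, statePart (R.f ω) z ∈ M.S
  /-- Posterior sampling: given the history, `fhat k` is a Gaussian process with the posterior
  mean and posterior covariance, expressed by its conditional characteristic functions. -/
  measurable_fhat : ∀ k ∈ Finset.Icc 1 M.K, ∀ z ∈ M.Dom, ∀ i,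
    Measurable fun ω => R.fhat k ω z i
  sample_law : ∀ k ∈ Finset.Icc 1 M.K, ∀ (n : ℕ) (z : Fin n → RLPair dS dA)
    (i : Fin n → Fin (dS + 1)) (c : Fin n → ℝ), (∀ l, z l ∈ M.Dom) →
    P[fun ω => Complex.exp (Complex.I * ((∑ l, c l * R.fhat k ω (z l) (i l) : ℝ) : ℂ)) |
        M.history R k] =ᵐ[P]
      fun ω => Complex.exp (Complex.I * ((∑ l, c l * M.postMean R k ω (z l) (i l) : ℝ) : ℂ) -
        (((1 / 2 : ℝ) * ∑ l, ∑ m, c l * c m * M.postCov R k ω (z l) (z m) (i l) (i m) : ℝ) : ℂ))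
  fhat_mem : ∀ᵐ ω ∂P, ∀ k ∈ Finset.Icc 1 M.K, ∀ z ∈ M.Dom, statePart (R.fhat k ω) z ∈ M.S
  /-- The environment chooses an initial state in each episode. -/
  measurable_s : ∀ k ∈ Finset.Icc 1 M.K, ∀ h ∈ Finset.Icc 1 M.H, Measurable (R.s h k)
  initial_mem : ∀ᵐ ω ∂P, ∀ k ∈ Finset.Icc 1 M.K, R.s 1 k ω ∈ M.S
  /-- Actions are greedy for the proxy. -/
  measurable_a : ∀ k ∈ Finset.Icc 1 M.K, ∀ h ∈ Finset.Icc 1 M.H, Measurable (R.a h k)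
  greedy : ∀ᵐ ω ∂P, ∀ k ∈ Finset.Icc 1 M.K, ∀ h ∈ Finset.Icc 1 M.H,
    R.a h k ω ∈ M.A ∧ IsMaxOn (M.proxyQ R h k ω (R.s h k ω)) M.A (R.a h k ω)
  /-- The environment moves to the next state. -/
  transition : ∀ᵐ ω ∂P, ∀ k ∈ Finset.Icc 1 M.K, ∀ h ∈ Finset.Icc 1 M.H,
    R.s (h + 1) k ω = statePart (R.f ω) (R.s h k ω, R.a h k ω)

/-- The sharp confidence multiplier in episode `k` at level `δ`: the smallest `b` such that each
scalar component of `f`, and each scalar component of the posterior sample `fhat k`, satisfies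
`|g(z) - μ_k(z)| ≤ b σ_k(z)` uniformly in `z` with probability at least `1 - δ`. -/
def sharpConfidence [MeasurableSpace Ω] (P : Measure Ω) (k : ℕ) (δ : ℝ) : ℝ≥0∞ :=
  ⨆ i : Fin (dS + 1), max
    (sharpMultiplier P M.Dom (fun ω z => R.f ω z i) (fun ω z => M.postMean R k ω z i)
      (fun ω z => M.postSd R k ω z i) δ)
    (sharpMultiplier P M.Dom (fun ω z => R.fhat k ω z i) (fun ω z => M.postMean R k ω z i)
      (fun ω z => M.postSd R k ω z i) δ)

/-- The confidence width `ξ_k = b σ_R + u_G b ‖σ_S‖ + (1/2) u_H b² ‖σ_S‖²`, for the multiplier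
`b` of episode `k`. -/
def width (uG uH b : ℝ) (k : ℕ) (ω : Ω) (z : RLPair dS dA) : ℝ :=
  b * rewardPart (M.postSd R k ω) z + uG * b * ‖statePart (M.postSd R k ω) z‖ +
    1 / 2 * uH * b ^ 2 * ‖statePart (M.postSd R k ω) z‖ ^ 2

/-- One-step reward of the upper confidence recursion, `μ_R + ξ_k`. -/
def upperReward (uG uH b : ℝ) (k : ℕ) (ω : Ω) (z : RLPair dS dA) : ℝ :=
  rewardPart (M.postMean R k ω) z + M.width R uG uH b k ω z

/-- One-step reward of the lower confidence recursion, `μ_R - ξ_k`. -/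
def lowerReward (uG uH b : ℝ) (k : ℕ) (ω : Ω) (z : RLPair dS dA) : ℝ :=
  rewardPart (M.postMean R k ω) z - M.width R uG uH b k ω z

/-- `Q^u_{h,k}(s, a) = μ_R(s, a) + V^u_{h+1,k}(μ_S(s, a)) + ξ_k(s, a)`. -/
def upperQ (uG uH b : ℝ) (h k : ℕ) (ω : Ω) : RLState dS → RLAction dA → ℝ :=
  backupQ M.A M.H (M.upperReward R uG uH b k ω) (statePart (M.postMean R k ω)) h

/-- `Q^l_{h,k}(s, a) = μ_R(s, a) + V^l_{h+1,k}(μ_S(s, a)) - ξ_k(s, a)`. -/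
def lowerQ (uG uH b : ℝ) (h k : ℕ) (ω : Ω) : RLState dS → RLAction dA → ℝ :=
  backupQ M.A M.H (M.lowerReward R uG uH b k ω) (statePart (M.postMean R k ω)) h

/-- The maxima that occur in the definitions of the value functions exist: there is an optimal
policy, and the maxima over actions in the proxy, upper and lower recursions are attained. -/
def ValuesWellDefined (uG uH : ℝ) (b : ℕ → ℝ) (ω : Ω) : Prop :=
  HasOptimalPolicy M.S M.A M.H (R.f ω) ∧
  ∀ k ∈ Finset.Icc 1 M.K,
    MaximaExist M.S M.A M.H (rewardPart (R.fhat k ω)) (statePart (R.fhat k ω)) ∧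
    MaximaExist M.S M.A M.H (M.upperReward R uG uH (b k) k ω) (statePart (M.postMean R k ω)) ∧
    MaximaExist M.S M.A M.H (M.lowerReward R uG uH (b k) k ω) (statePart (M.postMean R k ω))

/-- Smoothness of the value functions: `V*_h` and all proxies `V_{h,k}`. -/
def ValuesSmooth (uG uH : ℝ) (ω : Ω) : Prop :=
  ∀ h ∈ Finset.Icc 1 M.H, SmoothValue M.S (optV M.S M.A M.H (R.f ω) h) uG uH ∧
    ∀ k ∈ Finset.Icc 1 M.K, SmoothValue M.S (M.proxyV R h k ω) uG uH

end RLModel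

end

/-! The comparison runs through the value function whose smoothness is assumed. For `V` equal to the
optimal value or a proxy, replacing `(r, p)` by the posterior mean in `r(z) + V(p(z))` costs at most
`|r - μ_R| + |V(p) - V(μ_S)|`. Inside the confidence bands, and with `V` being `uG`-Lipschitz on the
convex set `S`, this is at most `β σ_R + uG β ‖σ_S‖`; the quadratic term of the width is slack
(`abs_lookahead_sub_le_width`). The upper and lower value functions need no smoothness: since `V`
solves its own Bellman equation, backward induction carries the one-step errors over to the two
recursions (`backupQ_enclosure`).

The probability is a union bound. Two functions, `d` outputs and `K` episodes fail with probability
at most `2 K d δ' = 2 δ / H`, which is at most `δ` once `H ≥ 2`. For `H = 1` no value of a next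
state enters, so only the reward band is needed, and `2 K δ' = 2 δ / d ≤ δ` because `d ≥ 2`. The
event is built without reference to smoothness, which is then used pathwise. -/

/-! ### Attainment of the sharp confidence multiplier -/

/-- The infimum defining the sharp multiplier is attained, and larger multipliers inherit the
bound: any finite upper bound is a valid confidence multiplier. -/
theorem measure_violation_le_of_sharpMultiplier_le {Ω Z : Type*} [MeasurableSpace Ω]
    {P : Measure Ω} {D : Set Z} {g m σ : Ω → Z → ℝ} (hσ : ∀ ω z, 0 ≤ σ ω z) {δ : ℝ} {b : ℝ≥0}
    (h : sharpMultiplier P D g m σ δ ≤ b) :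
    P {ω | ∃ z ∈ D, (b : ℝ) * σ ω z < |g ω z - m ω z|} ≤ ENNReal.ofReal δ := by
  have near : ∀ c : ℝ≥0, b < c →
      P {ω | ∃ z ∈ D, (c : ℝ) * σ ω z < |g ω z - m ω z|} ≤ ENNReal.ofReal δ := by
    intro c hc
    have hlt : sharpMultiplier P D g m σ δ < (c : ℝ≥0∞) :=
      h.trans_lt (ENNReal.coe_lt_coe.2 hc)
    unfold sharpMultiplier at hlt
    simp only [iInf_lt_iff] at hlt
    obtain ⟨b', hb', hlt⟩ := hlt
    refine (measure_mono ?_).trans hb'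
    rintro ω ⟨z, hz, hω⟩
    have hbc : (b' : ℝ) ≤ c := NNReal.coe_le_coe.2 (ENNReal.coe_lt_coe.1 hlt).le
    exact ⟨z, hz, (mul_le_mul_of_nonneg_right hbc (hσ ω z)).trans_lt hω⟩
  have hcoe : ∀ n : ℕ, ((b + 1 / ((n : ℝ≥0) + 1) : ℝ≥0) : ℝ) = b + 1 / ((n : ℝ) + 1) := by
    intro n
    push_cast
    rfl
  -- A strict inequality survives a small increase of the multiplier, so the violation sets at `b +
  -- 1/(n+1)` exhaust the one at `b`. Continuity from below along this monotone sequence needs no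
  -- measurability of the sets.
  have hsub : {ω | ∃ z ∈ D, (b : ℝ) * σ ω z < |g ω z - m ω z|} ⊆
      ⋃ n : ℕ, {ω | ∃ z ∈ D,
        ((b + 1 / ((n : ℝ≥0) + 1) : ℝ≥0) : ℝ) * σ ω z < |g ω z - m ω z|} := by
    rintro ω ⟨z, hz, hω⟩
    have hlim : Filter.Tendsto (fun n : ℕ => ((b : ℝ) + 1 / ((n : ℝ) + 1)) * σ ω z)
        Filter.atTop (nhds (((b : ℝ) + 0) * σ ω z)) :=
      (tendsto_const_nhds.add tendsto_one_div_add_atTop_nhds_zero_nat).mul_const _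
    rw [add_zero] at hlim
    obtain ⟨n, hn⟩ := (hlim.eventually_lt_const hω).exists
    exact Set.mem_iUnion.2 ⟨n, z, hz, by rwa [hcoe]⟩
  have hmono : Monotone fun n : ℕ => {ω | ∃ z ∈ D,
      ((b + 1 / ((n : ℝ≥0) + 1) : ℝ≥0) : ℝ) * σ ω z < |g ω z - m ω z|} := by
    rintro n n' hn ω ⟨z, hz, hω⟩
    refine ⟨z, hz, lt_of_le_of_lt (mul_le_mul_of_nonneg_right ?_ (hσ ω z)) hω⟩
    rw [hcoe, hcoe]
    gcongr
  refine (measure_mono hsub).trans ?_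
  rw [hmono.measure_iUnion]
  exact iSup_le fun n => near _ (lt_add_of_pos_right _ (by positivity))

/-! ### Lipschitz bounds, enclosure of recursions, Bellman equation -/

section Deterministic

variable {dS dA : ℕ}

/-- A value function with gradient bounded by `uG` on a convex set is `uG`-Lipschitz there. -/
theorem SmoothValue.abs_sub_le {S : Set (RLState dS)} (hS : Convex ℝ S) {v : RLState dS → ℝ}
    {uG uH : ℝ} (hv : SmoothValue S v uG uH) {x y : RLState dS} (hx : x ∈ S) (hy : y ∈ S) :
    |v x - v y| ≤ uG * ‖x - y‖ := by
  obtain ⟨v', v'', h⟩ := hv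
  exact hS.norm_image_sub_le_of_norm_hasFDerivWithin_le (fun z hz => (h z hz).1)
    (fun z hz => (h z hz).2.2.1) hy hx

theorem backupV_succ_horizon (A : Set (RLAction dA)) (H : ℕ) (r : RLPair dS dA → ℝ)
    (p : RLPair dS dA → RLState dS) (x : RLState dS) : backupV A H r p (H + 1) x = 0 := by
  simp [backupV, backupValue]

/-- Attainment makes the real `sSup` a genuine maximum instead of the default value `0` of an
unbounded or empty set. -/
theorem MaximaExist.exists_backupV_eq {S : Set (RLState dS)} {A : Set (RLAction dA)} {H : ℕ}
    {r : RLPair dS dA → ℝ} {p : RLPair dS dA → RLState dS} (hm : MaximaExist S A H r p)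
    {h : ℕ} (hh : h ∈ Finset.Icc 1 H) {x : RLState dS} (hx : x ∈ S) :
    ∃ a ∈ A, backupV A H r p h x = backupQ A H r p h x a ∧
      ∀ a' ∈ A, backupQ A H r p h x a' ≤ backupV A H r p h x := by
  obtain ⟨a, ha, hmax⟩ := hm h hh x hx
  have hg : IsGreatest (backupQ A H r p h x '' A) (backupQ A H r p h x a) :=
    ⟨⟨a, ha, rfl⟩, by rintro _ ⟨a', ha', rfl⟩; exact hmax ha'⟩
  have e : backupV A H r p h x = backupQ A H r p h x a := by
    rw [backupV_eq_sSup A H r p h (Finset.mem_Icc.1 hh).2, hg.csSup_eq]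
  exact ⟨a, ha, e, fun a' ha' => e ▸ hmax ha'⟩

/-- If `V` solves the Bellman equation for `(r, p)` on `S` and replacing `(r, p)` by `(r', p')`
changes every one-step lookahead by at most `w`, the recursions for `(r' ± w, p')` enclose it. -/
theorem backupQ_enclosure {S : Set (RLState dS)} {A : Set (RLAction dA)} {H : ℕ}
    {r r' w : RLPair dS dA → ℝ} {p p' : RLPair dS dA → RLState dS} {V : ℕ → RLState dS → ℝ}
    (hV : ∀ x, V (H + 1) x = 0)
    (hle : ∀ h ∈ Finset.Icc 1 H, ∀ x ∈ S, ∃ a ∈ A, V h x ≤ r (x, a) + V (h + 1) (p (x, a)))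
    (hge : ∀ h ∈ Finset.Icc 1 H, ∀ x ∈ S, ∀ a ∈ A, r (x, a) + V (h + 1) (p (x, a)) ≤ V h x)
    (hp' : ∀ z ∈ S ×ˢ A, p' z ∈ S)
    (hw : ∀ h ∈ Finset.Icc 1 H, ∀ z ∈ S ×ˢ A,
      |(r z + V (h + 1) (p z)) - (r' z + V (h + 1) (p' z))| ≤ w z)
    (hu : MaximaExist S A H (fun z => r' z + w z) p')
    (hl : MaximaExist S A H (fun z => r' z - w z) p')
    {h : ℕ} (hh : h ∈ Finset.Icc 1 H) {x : RLState dS} (hx : x ∈ S) {a : RLAction dA}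
    (ha : a ∈ A) :
    backupQ A H (fun z => r' z - w z) p' h x a ≤ r (x, a) + V (h + 1) (p (x, a)) ∧
      r (x, a) + V (h + 1) (p (x, a)) ≤ backupQ A H (fun z => r' z + w z) p' h x a := by
  obtain ⟨h1, hH⟩ := Finset.mem_Icc.1 hh
  clear hh
  induction hH using Nat.decreasingInduction generalizing x a with
  | self =>
    have := abs_le.1 (hw H (Finset.mem_Icc.2 ⟨h1, le_rfl⟩) (x, a) ⟨hx, ha⟩)
    simp only [backupQ, backupV_succ_horizon, hV] at this ⊢
    constructor <;> linarith
  | of_succ h hlt ih =>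
    have hh1 : h + 1 ∈ Finset.Icc 1 H := Finset.mem_Icc.2 ⟨by omega, hlt⟩
    have hy := hp' (x, a) ⟨hx, ha⟩
    have hb := abs_le.1 (hw h (Finset.mem_Icc.2 ⟨h1, hlt.le⟩) (x, a) ⟨hx, ha⟩)
    -- At `y = p' (x, a)`, the upper bound follows the action `ao` that is optimal for `V` and
    -- merely feasible for the upper recursion. The lower bound follows the maximiser `al` of the
    -- lower recursion, merely feasible for `V`.
    obtain ⟨au, -, -, hmu⟩ := hu.exists_backupV_eq hh1 hy
    obtain ⟨al, hal, hel, -⟩ := hl.exists_backupV_eq hh1 hy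
    obtain ⟨ao, hao, hVo⟩ := hle (h + 1) hh1 _ hy
    have h1' := (ih hy hao (by omega)).2
    have h2' := hmu ao hao
    have h3' := (ih hy hal (by omega)).1
    have h4' := hge (h + 1) hh1 _ hy al hal
    simp only [backupQ] at hel h1' h2' h3' ⊢
    constructor <;> linarith

/-! ### Bellman equation for the optimal value function -/

section Bellman

variable {S : Set (RLState dS)} {A : Set (RLAction dA)} {H : ℕ} {g : RLPair dS dA → RLOut dS}

/-- The definition unrolls the last step; the Bellman equation needs the first one split off. -/
theorem policyState_succ (g : RLPair dS dA → RLOut dS) (π : ℕ → RLState dS → RLAction dA)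
    (h : ℕ) (x : RLState dS) (n : ℕ) :
    policyState g π h x (n + 1) = policyState g π (h + 1) (statePart g (x, π h x)) n := by
  induction n with
  | zero => rfl
  | succ n ih =>
    rw [policyState, ih, policyState, show h + (n + 1) = h + 1 + n by omega]

theorem policyV_eq_policyQ (π : ℕ → RLState dS → RLAction dA) {h : ℕ} (hh : h ≤ H)
    (x : RLState dS) : policyV H g π h x = policyQ H g π h x (π h x) := by
  unfold policyV policyQ policyV
  rw [show H + 1 - h = (H + 1 - (h + 1)) + 1 by omega, Finset.sum_range_succ', add_comm]
  congr 1
  refine Finset.sum_congr rfl fun n _ => ?_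
  rw [policyState_succ, show h + (n + 1) = h + 1 + n by omega]

theorem policyState_congr {π π' : ℕ → RLState dS → RLAction dA} {h : ℕ}
    (e : ∀ j, h ≤ j → π j = π' j) (x : RLState dS) (n : ℕ) :
    policyState g π h x n = policyState g π' h x n := by
  induction n with
  | zero => rfl
  | succ n ih => rw [policyState, policyState, ih, e (h + n) (by omega)]

theorem policyV_congr {π π' : ℕ → RLState dS → RLAction dA} {h : ℕ}
    (e : ∀ j, h ≤ j → π j = π' j) (x : RLState dS) : policyV H g π h x = policyV H g π' h x := by
  refine Finset.sum_congr rfl fun n _ => ?_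
  rw [policyState_congr e, e (h + n) (by omega)]

theorem policyV_succ_horizon (π : ℕ → RLState dS → RLAction dA) (x : RLState dS) :
    policyV H g π (H + 1) x = 0 := by
  simp [policyV]

theorem optV_succ_horizon (x : RLState dS) : optV S A H g (H + 1) x = 0 := by
  simp [optV, policyV_succ_horizon]

/-- The range includes step `H + 1`, where every policy has value `0`, so that the Bellman relations
below can evaluate `optV` at `h + 1` even for `h = H`. -/
theorem HasOptimalPolicy.exists_optimal (hopt : HasOptimalPolicy S A H g) :
    ∃ π, IsPolicy S A π ∧ ∀ h ∈ Finset.Icc 1 (H + 1), ∀ x ∈ S,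
      optV S A H g h x = policyV H g π h x ∧
        ∀ π', IsPolicy S A π' → policyV H g π' h x ≤ policyV H g π h x := by
  obtain ⟨π, hπ, hbest⟩ := hopt
  refine ⟨π, hπ, fun h hh x hx => ?_⟩
  have hb : ∀ π', IsPolicy S A π' → policyV H g π' h x ≤ policyV H g π h x := by
    intro π' hπ'
    obtain ⟨h1, h2⟩ := Finset.mem_Icc.1 hh
    rcases Nat.lt_or_ge H h with hlt | hle
    · obtain rfl : h = H + 1 := by omega
      simp [policyV_succ_horizon]
    · exact hbest h (Finset.mem_Icc.2 ⟨h1, hle⟩) x hx π' hπ'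
  refine ⟨IsGreatest.csSup_eq (s := Set.range fun π : {π // IsPolicy S A π} => policyV H g π h x)
    ⟨⟨⟨π, hπ⟩, rfl⟩, ?_⟩, hb⟩
  rintro _ ⟨π', rfl⟩
  exact hb π' π'.2

/-- The first reward does not depend on the policy, so a policy optimal from the next state also
attains the supremum defining `optQ`. -/
theorem HasOptimalPolicy.optQ_eq (hopt : HasOptimalPolicy S A H g) {h : ℕ}
    (hh : h ∈ Finset.Icc 1 H) {x : RLState dS} {a : RLAction dA} (hg : statePart g (x, a) ∈ S) :
    optQ S A H g h x a = rewardPart g (x, a) + optV S A H g (h + 1) (statePart g (x, a)) := by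
  obtain ⟨π, hπ, hbest⟩ := hopt.exists_optimal
  obtain ⟨h1, h2⟩ := Finset.mem_Icc.1 hh
  obtain ⟨e, hb⟩ := hbest (h + 1) (Finset.mem_Icc.2 ⟨by omega, by omega⟩) _ hg
  rw [e]
  refine IsGreatest.csSup_eq (s := Set.range fun π : {π // IsPolicy S A π} => policyQ H g π h x a)
    ⟨⟨⟨π, hπ⟩, rfl⟩, ?_⟩
  rintro _ ⟨π', rfl⟩
  exact add_le_add_right (hb π' π'.2) _

theorem HasOptimalPolicy.exists_optV_le (hopt : HasOptimalPolicy S A H g)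
    (hg : ∀ z ∈ S ×ˢ A, statePart g z ∈ S) {h : ℕ} (hh : h ∈ Finset.Icc 1 H)
    {x : RLState dS} (hx : x ∈ S) :
    ∃ a ∈ A, optV S A H g h x ≤
      rewardPart g (x, a) + optV S A H g (h + 1) (statePart g (x, a)) := by
  obtain ⟨π, hπ, hbest⟩ := hopt.exists_optimal
  obtain ⟨h1, h2⟩ := Finset.mem_Icc.1 hh
  refine ⟨π h x, hπ h x hx, ?_⟩
  rw [(hbest h (Finset.mem_Icc.2 ⟨h1, by omega⟩) x hx).1,
    (hbest (h + 1) (Finset.mem_Icc.2 ⟨by omega, by omega⟩) _ (hg _ ⟨hx, hπ h x hx⟩)).1,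
    policyV_eq_policyQ π h2]
  rfl

theorem HasOptimalPolicy.le_optV (hopt : HasOptimalPolicy S A H g)
    (hg : ∀ z ∈ S ×ˢ A, statePart g z ∈ S) {h : ℕ} (hh : h ∈ Finset.Icc 1 H)
    {x : RLState dS} (hx : x ∈ S) {a : RLAction dA} (ha : a ∈ A) :
    rewardPart g (x, a) + optV S A H g (h + 1) (statePart g (x, a)) ≤ optV S A H g h x := by
  obtain ⟨π, hπ, hbest⟩ := hopt.exists_optimal
  obtain ⟨h1, h2⟩ := Finset.mem_Icc.1 hh
  obtain ⟨e, hb⟩ := hbest h (Finset.mem_Icc.2 ⟨h1, by omega⟩) x hx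
  rw [e, (hbest (h + 1) (Finset.mem_Icc.2 ⟨by omega, by omega⟩) _ (hg _ ⟨hx, ha⟩)).1]
  -- Policies may depend on the step, so changing the action at step `h` alone leaves all values
  -- from step `h + 1` on untouched.
  set π' : ℕ → RLState dS → RLAction dA := Function.update π h fun _ => a with hπ'def
  have hπ' : IsPolicy S A π' := by
    intro j y hy
    rcases eq_or_ne j h with rfl | hj
    · simpa [hπ'def] using ha
    · simpa [hπ'def, hj] using hπ j y hy
  have hπ'h : π' h x = a := by simp [hπ'def]
  have hagree : ∀ j, h + 1 ≤ j → π j = π' j := fun j hj => by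
    rw [hπ'def, Function.update_of_ne (by omega)]
  refine le_trans (le_of_eq ?_) (hb π' hπ')
  rw [policyV_eq_policyQ π' h2, hπ'h, policyQ, policyV_congr hagree]

end Bellman

/-- Coordinatewise confidence bounds on the next state bound the Euclidean error. -/
theorem norm_statePart_sub_le {g m σ : RLPair dS dA → RLOut dS} {b : ℝ} (hb : 0 ≤ b)
    {z : RLPair dS dA} (h : ∀ i : Fin dS, |g z i.succ - m z i.succ| ≤ b * σ z i.succ) :
    ‖statePart g z - statePart m z‖ ≤ b * ‖statePart σ z‖ := by
  rw [← abs_of_nonneg hb, ← Real.norm_eq_abs, ← norm_smul, EuclideanSpace.norm_eq,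
    EuclideanSpace.norm_eq]
  refine Real.sqrt_le_sqrt (Finset.sum_le_sum fun i _ => ?_)
  simp only [statePart, PiLp.sub_apply, PiLp.smul_apply, smul_eq_mul, Real.norm_eq_abs]
  exact pow_le_pow_left₀ (abs_nonneg _) ((h i).trans (le_abs_self _)) 2

end Deterministic

/-! ### Confidence bands and the one-step prediction error -/

namespace RLModel

variable {dS dA : ℕ} {Ω : Type*} (M : RLModel dS dA) (R : RLRun dS dA Ω)

/-- The outputs that enter the value functions: with a single step per episode, only the reward. -/
def relevantOutputs : Finset (Fin (dS + 1)) := if M.H = 1 then {0} else Finset.univ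

theorem zero_mem_relevantOutputs : 0 ∈ M.relevantOutputs := by
  unfold relevantOutputs
  split_ifs <;> simp

theorem mem_relevantOutputs {h : ℕ} (h1 : 1 ≤ h) (hH : h < M.H) (i : Fin (dS + 1)) :
    i ∈ M.relevantOutputs := by
  rw [relevantOutputs, if_neg (by omega)]
  exact Finset.mem_univ i

/-- The factor `2`, for `f` and `fhat`, is absorbed by `H` if `H ≥ 2` and by `dS + 1 ≥ 2` if `H =
1`. -/
theorem two_mul_card_relevantOutputs_le (hdS : 0 < dS) (hH : 0 < M.H) :
    2 * M.relevantOutputs.card ≤ M.H * (dS + 1) := by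
  unfold relevantOutputs
  split_ifs with h
  · simp only [Finset.card_singleton, h]; omega
  · simp only [Finset.card_univ, Fintype.card_fin]
    exact Nat.mul_le_mul_right _ (by omega)

/-- The output `i` of `g` leaves its confidence band in episode `k`. -/
def violation (g : Ω → RLPair dS dA → RLOut dS) (b : ℝ) (k : ℕ) (i : Fin (dS + 1)) : Set Ω :=
  {ω | ∃ z ∈ M.Dom, b * M.postSd R k ω z i < |g ω z i - M.postMean R k ω z i|}

variable {M R}

theorem measure_violation_le [MeasurableSpace Ω] {P : Measure Ω} {k : ℕ} {δ : ℝ} {b : ℝ≥0}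
    (h : M.sharpConfidence R P k δ ≤ b) (i : Fin (dS + 1)) :
    P (M.violation R R.f b k i ∪ M.violation R (R.fhat k) b k i) ≤ ENNReal.ofReal (2 * δ) := by
  have hi := (le_iSup (fun i : Fin (dS + 1) => max
    (sharpMultiplier P M.Dom (fun ω z => R.f ω z i) (fun ω z => M.postMean R k ω z i)
      (fun ω z => M.postSd R k ω z i) δ)
    (sharpMultiplier P M.Dom (fun ω z => R.fhat k ω z i) (fun ω z => M.postMean R k ω z i)
      (fun ω z => M.postSd R k ω z i) δ)) i).trans h
  have hsd : ∀ ω z, 0 ≤ M.postSd R k ω z i := fun ω z => Real.sqrt_nonneg _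
  refine (measure_union_le _ _).trans ?_
  rw [ENNReal.ofReal_mul two_pos.le, ENNReal.ofReal_ofNat, two_mul]
  exact add_le_add
    (measure_violation_le_of_sharpMultiplier_le hsd ((le_max_left _ _).trans hi))
    (measure_violation_le_of_sharpMultiplier_le hsd ((le_max_right _ _).trans hi))

/-- Within the confidence bands and for a smooth value function, the posterior mean predicts a
one-step lookahead up to the confidence width. -/
theorem abs_lookahead_sub_le_width (hS : Convex ℝ M.S) {uG uH : ℝ} (huG : 0 ≤ uG) (huH : 0 ≤ uH)
    {b : ℝ≥0} {k : ℕ} {ω : Ω} {g : RLPair dS dA → RLOut dS} {V : ℕ → RLState dS → ℝ}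
    (hV : ∀ x, V (M.H + 1) x = 0)
    (hsmooth : ∀ h ∈ Finset.Icc 1 M.H, SmoothValue M.S (V h) uG uH)
    (hg : ∀ z ∈ M.Dom, statePart g z ∈ M.S)
    (hm : ∀ z ∈ M.Dom, statePart (M.postMean R k ω) z ∈ M.S)
    (hband : ∀ i ∈ M.relevantOutputs, ∀ z ∈ M.Dom,
      |g z i - M.postMean R k ω z i| ≤ b * M.postSd R k ω z i)
    {h : ℕ} (hh : h ∈ Finset.Icc 1 M.H) {z : RLPair dS dA} (hz : z ∈ M.Dom) :
    |(rewardPart g z + V (h + 1) (statePart g z)) -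
      (rewardPart (M.postMean R k ω) z + V (h + 1) (statePart (M.postMean R k ω) z))| ≤
        M.width R uG uH b k ω z := by
  obtain ⟨h1, hH⟩ := Finset.mem_Icc.1 hh
  have hr : |rewardPart g z - rewardPart (M.postMean R k ω) z| ≤
      b * rewardPart (M.postSd R k ω) z := hband 0 M.zero_mem_relevantOutputs z hz
  have hs : |V (h + 1) (statePart g z) - V (h + 1) (statePart (M.postMean R k ω) z)| ≤
      uG * b * ‖statePart (M.postSd R k ω) z‖ := by
    -- At `h = H` the next value vanishes, so no state band is needed. If `h < H`, then `H ≠ 1` and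
    -- all outputs are relevant.
    rcases hH.eq_or_lt with rfl | hlt
    · rw [hV, hV, sub_zero, abs_zero]
      positivity
    · refine ((hsmooth (h + 1) (Finset.mem_Icc.2 ⟨by omega, hlt⟩)).abs_sub_le hS
        (hg z hz) (hm z hz)).trans ?_
      rw [mul_assoc]
      exact mul_le_mul_of_nonneg_left (norm_statePart_sub_le b.2 fun i =>
        hband i.succ (M.mem_relevantOutputs h1 hlt _) z hz) huG
  have hq : 0 ≤ 1 / 2 * uH * (b : ℝ) ^ 2 * ‖statePart (M.postSd R k ω) z‖ ^ 2 := by positivity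
  rw [add_sub_add_comm]
  refine (abs_add_le _ _).trans ?_
  unfold width
  linarith

end RLModel

/-! ### Union bound and pathwise conclusion -/

theorem corollary1 {dS dA : ℕ} (hdS : 0 < dS) (M : RLModel dS dA)
    (hlam : 0 < M.lam) (hS : Convex ℝ M.S)
    {Ω : Type*} [MeasurableSpace Ω] (P : Measure Ω) [IsProbabilityMeasure P]
    (R : RLRun dS dA Ω) (hR : M.IsRLGPS R P)
    (uG uH δ : ℝ) (hδ : δ ∈ Set.Ioo (0 : ℝ) 1)
    -- the level at which the multipliers are used: δ / (T d), with T = K H and d = dS + 1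
    (δ' : ℝ) (hδ' : δ' = δ / (((M.K * M.H : ℕ) : ℝ) * ((dS + 1 : ℕ) : ℝ)))
    -- β is any finite upper bound for the sharp confidence multipliers
    (β : ℕ → ℝ → ℝ≥0)
    (hβ : ∀ k ∈ Finset.Icc 1 M.K, M.sharpConfidence R P k δ' ≤ (β k δ' : ℝ≥0∞))
    -- the objects in the recursions are well defined
    (hmean : ∀ᵐ ω ∂P, ∀ k ∈ Finset.Icc 1 M.K, ∀ z ∈ M.Dom, statePart (M.postMean R k ω) z ∈ M.S)
    (hmax : ∀ᵐ ω ∂P, M.ValuesWellDefined R uG uH (fun k => (β k δ' : ℝ)) ω) :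
    ∃ G : Set Ω, MeasurableSet G ∧ ENNReal.ofReal (1 - δ) ≤ P G ∧
      ∀ ω ∈ G, M.ValuesSmooth R uG uH ω →
        ∀ h ∈ Finset.Icc 1 M.H, ∀ k ∈ Finset.Icc 1 M.K, ∀ s ∈ M.S, ∀ a ∈ M.A,
          (M.lowerQ R uG uH (β k δ') h k ω s a ≤ M.proxyQ R h k ω s a ∧
            M.proxyQ R h k ω s a ≤ M.upperQ R uG uH (β k δ') h k ω s a) ∧
          (M.lowerQ R uG uH (β k δ') h k ω s a ≤ optQ M.S M.A M.H (R.f ω) h s a ∧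
            optQ M.S M.A M.H (R.f ω) h s a ≤ M.upperQ R uG uH (β k δ') h k ω s a) := by
  have hδ0 : 0 < δ := hδ.1
  let bad : Set Ω := ⋃ k ∈ Finset.Icc 1 M.K, ⋃ i ∈ M.relevantOutputs,
    M.violation R R.f (β k δ' : ℝ) k i ∪ M.violation R (R.fhat k) (β k δ' : ℝ) k i
  have hbad : P bad ≤ ENNReal.ofReal δ := by
    rcases Nat.eq_zero_or_pos M.K with hK | hK
    · simp [bad, hK]
    rcases Nat.eq_zero_or_pos M.H with hH | hH
    -- For `H = 0` division by zero gives `δ' = 0`, so every violation set is null.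
    · have hδ'0 : δ' = 0 := by simp [hδ', hH]
      have hnull : ∀ k ∈ Finset.Icc 1 M.K, ∀ i,
          P (M.violation R R.f (β k δ' : ℝ) k i ∪ M.violation R (R.fhat k) (β k δ' : ℝ) k i) = 0 :=
        fun k hk i => by
          simpa [hδ'0] using RLModel.measure_violation_le (hβ k hk) i
      have : P bad = 0 := by
        simp only [bad]
        refine (measure_biUnion_null_iff (Finset.countable_toSet _)).2 fun k hk => ?_
        exact (measure_biUnion_null_iff (Finset.countable_toSet _)).2 fun i _ => hnull k hk i
      simp [this]
    have hδ'0 : 0 ≤ δ' := by rw [hδ']; positivity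
    calc P bad ≤ ∑ k ∈ Finset.Icc 1 M.K, ∑ i ∈ M.relevantOutputs, ENNReal.ofReal (2 * δ') := by
          refine (measure_biUnion_finset_le _ _).trans (Finset.sum_le_sum fun k hk => ?_)
          exact (measure_biUnion_finset_le _ _).trans
            (Finset.sum_le_sum fun i _ => RLModel.measure_violation_le (hβ k hk) i)
      _ = ENNReal.ofReal (M.K * (M.relevantOutputs.card * (2 * δ'))) := by
          rw [ENNReal.ofReal_mul (by positivity), ENNReal.ofReal_mul (by positivity)]
          simp
      _ ≤ ENNReal.ofReal δ := by
          refine ENNReal.ofReal_le_ofReal ?_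
          have hcard : (2 : ℝ) * M.relevantOutputs.card ≤ M.H * ((dS + 1 : ℕ) : ℝ) := by
            exact_mod_cast M.two_mul_card_relevantOutputs_le hdS hH
          have hKr : (0 : ℝ) < M.K := by exact_mod_cast hK
          have hHr : (0 : ℝ) < M.H := by exact_mod_cast hH
          have hd : (0 : ℝ) < ((dS + 1 : ℕ) : ℝ) := by positivity
          have hδeq : δ = M.K * (M.H * ((dS + 1 : ℕ) : ℝ) * δ') := by
            rw [hδ', Nat.cast_mul]
            field_simp
          calc (M.K : ℝ) * (M.relevantOutputs.card * (2 * δ'))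
              = M.K * (2 * M.relevantOutputs.card * δ') := by ring
            _ ≤ M.K * (M.H * ((dS + 1 : ℕ) : ℝ) * δ') := by gcongr
            _ = δ := hδeq.symm
  let good : Set Ω := {ω | (∀ z ∈ M.Dom, statePart (R.f ω) z ∈ M.S) ∧
    (∀ k ∈ Finset.Icc 1 M.K, ∀ z ∈ M.Dom, statePart (R.fhat k ω) z ∈ M.S) ∧
    (∀ k ∈ Finset.Icc 1 M.K, ∀ z ∈ M.Dom, statePart (M.postMean R k ω) z ∈ M.S) ∧
    M.ValuesWellDefined R uG uH (fun k => (β k δ' : ℝ)) ω}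
  have hgood : P goodᶜ = 0 := by
    change ∀ᵐ ω ∂P, ω ∈ good
    filter_upwards [hR.f_mem, hR.fhat_mem, hmean, hmax] with ω h1 h2 h3 h4
    exact ⟨h1, h2, h3, h4⟩
  -- The violation sets quantify over possibly uncountably many `z` and need not be measurable; a
  -- measurable hull of the same measure replaces them.
  refine ⟨(toMeasurable P (bad ∪ goodᶜ))ᶜ, (measurableSet_toMeasurable _ _).compl, ?_, ?_⟩
  · have hle : P (bad ∪ goodᶜ) ≤ ENNReal.ofReal δ :=
      (measure_union_le _ _).trans (by rw [hgood, add_zero]; exact hbad)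
    rw [prob_compl_eq_one_sub (measurableSet_toMeasurable _ _), measure_toMeasurable,
      ENNReal.ofReal_sub _ hδ0.le, ENNReal.ofReal_one]
    exact tsub_le_tsub_left hle 1
  intro ω hω hsmooth h hh k hk s hs a ha
  have hω' : ω ∉ bad ∪ goodᶜ := fun hmem => hω (subset_toMeasurable _ _ hmem)
  simp only [Set.mem_union, not_or, Set.mem_compl_iff, not_not] at hω'
  obtain ⟨hnb, hf, hfhat, hm, hopt, hwd⟩ := hω'
  obtain ⟨hmp, hmu, hml⟩ := hwd k hk
  have hband : ∀ i ∈ M.relevantOutputs, ∀ z ∈ M.Dom,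
      |R.f ω z i - M.postMean R k ω z i| ≤ (β k δ' : ℝ) * M.postSd R k ω z i ∧
      |R.fhat k ω z i - M.postMean R k ω z i| ≤ (β k δ' : ℝ) * M.postSd R k ω z i := by
    intro i hi z hz
    by_contra hcon
    refine hnb (Set.mem_biUnion hk (Set.mem_biUnion hi ?_))
    rcases not_and_or.1 hcon with hc | hc
    · exact Or.inl ⟨z, hz, not_le.1 hc⟩
    · exact Or.inr ⟨z, hz, not_le.1 hc⟩
  obtain ⟨v', v'', hv⟩ := (hsmooth h hh).1
  -- The signs of `uG` and `uH` are not assumed: smoothness at the point `s` forces them.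
  have huG : 0 ≤ uG := (norm_nonneg _).trans (hv s hs).2.2.1
  have huH : 0 ≤ uH := le_trans (norm_nonneg (v'' s)) (hv s hs).2.2.2
  constructor
  · refine backupQ_enclosure (S := M.S) (V := fun h => M.proxyV R h k ω)
      (backupV_succ_horizon _ _ _ _) ?_ ?_ (hm k hk) ?_ hmu hml hh hs ha
    · intro j hj x hx
      obtain ⟨a', ha', e, -⟩ := hmp.exists_backupV_eq hj hx
      exact ⟨a', ha', e.le⟩
    · intro j hj x hx a' ha'
      obtain ⟨-, -, -, hle⟩ := hmp.exists_backupV_eq hj hx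
      exact hle a' ha'
    · intro j hj z hz
      exact RLModel.abs_lookahead_sub_le_width (V := fun h => M.proxyV R h k ω) hS huG huH
        (backupV_succ_horizon _ _ _ _) (fun j hj => (hsmooth j hj).2 k hk)
        (hfhat k hk) (hm k hk) (fun i hi z hz => (hband i hi z hz).2) hj hz
  · rw [hopt.optQ_eq hh (hf _ ⟨hs, ha⟩)]
    refine backupQ_enclosure (S := M.S) (V := optV M.S M.A M.H (R.f ω))
      optV_succ_horizon (fun j hj x hx => hopt.exists_optV_le hf hj hx)
      (fun j hj x hx a' ha' => hopt.le_optV hf hj hx ha') (hm k hk) ?_ hmu hml hh hs ha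
    intro j hj z hz
    exact RLModel.abs_lookahead_sub_le_width hS huG huH optV_succ_horizon
      (fun j hj => (hsmooth j hj).1) hf (hm k hk) (fun i hi z hz => (hband i hi z hz).1) hj hz
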